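/- Let $n\ge 0$, let $A,B$ be arbitrary complex $n\times n$ matrices, let $I$ be the $n\times n$ identity matrix and let $$\mathbb S=\begin{pmatrix}A&I\\ I&B\end{pmatrix}$$ be the corresponding $2n\times 2n$ block matrix. Let $f:[0,\infty)\to[0,\infty)$ be concave and e-convex, the latter meaning that $t\mapsto f(e^t)$ is convex on $(-\infty,\infty)$. For a matrix $X$ write $|X|=(X^*X)^{1/2}$, and let $f(|X|)$ be defined by the functional calculus. Then for every symmetric norm $\|\cdot\|$, that is, every norm on the complex $2n\times 2n$ matrices with $\|UXV\|=\|X\|$ for all $X$ and all unitaries $U,V$, $$\|f(|\mathbb S|)\|\le\big\|\,f(|A^*|)+2f(I)+f(|B|)\,\big\|,$$ where, as usual, the norm of an $n\times n$ matrix $Y$ means $\|Y\oplus 0\|=\left\|\begin{pmatrix}Y&0\\0&0\end{pmatrix}\right\|$. -/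

import Mathlib

open scoped Matrix MatrixOrder

noncomputable section

/-- A symmetric (unitarily invariant) norm on the complex square matrices indexed by `m`: a norm
with `‖U X V‖ = ‖X‖` for all `X` and all unitaries `U`, `V`. -/
structure SymmetricNorm (m : Type*) [Fintype m] [DecidableEq m] extends
    Seminorm ℂ (Matrix m m ℂ) where
  eq_zero_of_map_eq_zero' : ∀ X : Matrix m m ℂ, toFun X = 0 → X = 0
  unitary_invariant' : ∀ U ∈ Matrix.unitaryGroup m ℂ, ∀ V ∈ Matrix.unitaryGroup m ℂ,
    ∀ X : Matrix m m ℂ, toFun (U * X * V) = toFun X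

instance {m : Type*} [Fintype m] [DecidableEq m] :
    CoeFun (SymmetricNorm m) (fun _ => Matrix m m ℂ → ℝ) :=
  ⟨fun N => N.toSeminorm⟩

/-- The linear embedding `X ↦ X ⊕ 0` of `n × n` matrices into `2n × 2n` matrices. -/
def padZero (n : Type*) : Matrix n n ℂ →ₗ[ℂ] Matrix (n ⊕ n) (n ⊕ n) ℂ where
  toFun X := Matrix.fromBlocks X 0 0 0
  map_add' X Y := by simp [Matrix.fromBlocks_add]
  map_smul' c X := by simp [Matrix.fromBlocks_smul]

/-- The value of a symmetric norm on an operator of the smaller space: an operator `X` on `H` is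
measured as the operator `X ⊕ 0` on `H ⊕ H` (same nonzero singular values). The result is again a
symmetric norm. -/
def SymmetricNorm.restrict {n : Type*} [Fintype n] [DecidableEq n]
    (N : SymmetricNorm (n ⊕ n)) : SymmetricNorm n where
  toSeminorm := N.toSeminorm.comp (padZero n)
  eq_zero_of_map_eq_zero' X h := by
    have h0 : Matrix.fromBlocks X 0 0 (0 : Matrix n n ℂ) = 0 := N.eq_zero_of_map_eq_zero' _ h
    rw [← Matrix.fromBlocks_zero, Matrix.fromBlocks_inj] at h0
    exact h0.1
  unitary_invariant' U hU V hV X := by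
    have key : ∀ W ∈ Matrix.unitaryGroup n ℂ,
        Matrix.fromBlocks W 0 0 (1 : Matrix n n ℂ) ∈ Matrix.unitaryGroup (n ⊕ n) ℂ := by
      intro W hW
      rw [Matrix.mem_unitaryGroup_iff, Matrix.star_eq_conjTranspose] at hW ⊢
      simp [Matrix.fromBlocks_conjTranspose, Matrix.fromBlocks_multiply, hW]
    have h := N.unitary_invariant' _ (key U hU) _ (key V hV) (Matrix.fromBlocks X 0 0 0)
    simp only [Matrix.fromBlocks_multiply, mul_zero, zero_mul, add_zero, mul_one] at h
    exact h

/-- A function on `[0, ∞)` is e-convex if `t ↦ f (e ^ t)` is convex on the real line. -/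
def EConvex (f : ℝ → ℝ) : Prop :=
  ConvexOn ℝ Set.univ (fun t : ℝ => f (Real.exp t))

end

/-! With singular value decompositions of `A` and `B`, the block matrix is `Z₁ E Z₂ᴴ + Γ`, where `E
≥ 0` is diagonal with entries `e i` (the singular values of `A` and `B` together) and `Γ`, the swap
of the summands, is unitary. It factors as `Xᴴ Y` with both `Xᴴ X` and `Yᴴ Y` unitarily similar to
`E + 1`. Cauchy–Schwarz for determinants, applied to compressions, bounds every product of `k`
singular values `σ` by the product of the `k` largest `e i + 1`
(`prod_le_prod_of_conjTranspose_mul_eq_diagonal`).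

A monotone e-convex `f` turns this weak log-majorization into a norm inequality
(`map_diagonal_comp_le`). A nonnegative concave `f` is monotone and subadditive, so `f (e i + 1) ≤ f
(e i) + f 1`. The resulting diagonal matrix is unitarily similar to a direct sum of two positive
blocks, whose norm is at most that of their sum (`map_fromBlocks_le_restrict_add`). -/

section
open scoped ComplexOrder

/-! ### Determinant inequalities and multiplicative majorization. -/

namespace Matrix

variable {m p κ : Type*} [Fintype m] [DecidableEq m] [Fintype p] [Fintype κ] [DecidableEq κ]

theorem posSemidef_diagonal_ofReal {m : Type*} [DecidableEq m] {x : m → ℝ} (hx : ∀ i, 0 ≤ x i) :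
    (diagonal fun i => (x i : ℂ)).PosSemidef :=
  posSemidef_diagonal_iff.2 fun i => Complex.zero_le_real.2 (hx i)

theorem PosSemidef.one_le_det_one_add {C : Matrix m m ℂ} (hC : C.PosSemidef) :
    1 ≤ (1 + C).det := by
  have hs := hC.1.spectral_theorem
  set U := hC.1.eigenvectorUnitary
  rw [Unitary.conjStarAlgAut_apply] at hs
  have h1 : (1 + C) = (U : Matrix m m ℂ) *
      (1 + diagonal (RCLike.ofReal ∘ hC.1.eigenvalues)) * (star U : Matrix m m ℂ) := by
    rw [mul_add, add_mul, ← hs, mul_one, ← Unitary.coe_star, Unitary.coe_mul_star_self]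
  have h2 : (1 + C).det = ∏ i, (1 + (hC.1.eigenvalues i : ℂ)) := by
    rw [h1, det_mul_comm, ← mul_assoc, Unitary.coe_star_mul_self, one_mul, ← diagonal_one,
      diagonal_add, det_diagonal]
    rfl
  have h3 : (1 : ℝ) ≤ ∏ i, (1 + hC.1.eigenvalues i) :=
    Finset.one_le_prod fun i _ => le_add_of_nonneg_right (hC.eigenvalues_nonneg i)
  rw [h2]
  exact_mod_cast h3

/-- If `A` is invertible and `B - A = Rᴴ R`, then `B = A (1 + A⁻¹ Rᴴ R)`, and Sylvester's identity
replaces the second determinant by that of `1 + R A⁻¹ Rᴴ`, which is at least 1. -/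
theorem PosSemidef.det_le_det {A B : Matrix m m ℂ} (hA : A.PosSemidef)
    (hAB : (B - A).PosSemidef) : A.det ≤ B.det := by
  have hB : B.PosSemidef := by simpa using hA.add hAB
  by_cases h0 : A.det = 0
  · rw [h0]; exact hB.det_nonneg
  have hA' : A.PosDef := hA.posDef_iff_det_ne_zero.2 h0
  have hu : IsUnit A.det := isUnit_iff_ne_zero.2 h0
  obtain ⟨R, hR⟩ := CStarAlgebra.nonneg_iff_eq_star_mul_self.1 (nonneg_iff_posSemidef.2 hAB)
  have hB' : B = A * (1 + A⁻¹ * Rᴴ * R) := by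
    rw [mul_add, mul_one, mul_assoc, ← mul_assoc, mul_nonsing_inv _ hu, one_mul,
      ← star_eq_conjTranspose, ← hR]
    simp
  have hP : (R * (A⁻¹ * Rᴴ)).PosSemidef := by
    rw [← mul_assoc]; exact hA'.inv.posSemidef.mul_mul_conjTranspose_same R
  rw [hB', det_mul, det_one_add_mul_comm]
  exact le_mul_of_one_le_right hA.det_nonneg hP.one_le_det_one_add

/-- Cauchy–Schwarz for determinants: the Gram matrix of the columns of `X` and `Y` is positive
semidefinite, so its Schur complement is too; then take determinants. -/
theorem norm_det_conjTranspose_mul_sq_le {X Y : Matrix p κ ℂ} (hX : (Xᴴ * X).PosDef) :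
    ((‖(Xᴴ * Y).det‖ ^ 2 : ℝ) : ℂ) ≤ (Xᴴ * X).det * (Yᴴ * Y).det := by
  have hu : IsUnit (Xᴴ * X).det := isUnit_iff_ne_zero.2 hX.det_pos.ne'
  have hblock : (fromBlocks (Xᴴ * X) (Xᴴ * Y) (Xᴴ * Y)ᴴ (Yᴴ * Y)).PosSemidef := by
    have := posSemidef_conjTranspose_mul_self (fromCols X Y)
    rwa [conjTranspose_fromCols_eq_fromRows_conjTranspose, fromRows_mul_fromCols,
      show Yᴴ * X = (Xᴴ * Y)ᴴ by simp] at this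
  have : Invertible (Xᴴ * X) := invertibleOfIsUnitDet _ hu
  have h1 := (PosDef.fromBlocks₁₁ (Xᴴ * Y) (Yᴴ * Y) hX).1 hblock
  have h2 := (hX.inv.posSemidef.conjTranspose_mul_mul_same (Xᴴ * Y)).det_le_det h1
  rw [det_mul, det_mul, det_conjTranspose] at h2
  have h3 := mul_le_mul_of_nonneg_left h2 hX.posSemidef.det_nonneg
  refine le_trans (le_of_eq ?_) h3
  have h4 : (Xᴴ * X).det * (Xᴴ * X)⁻¹.det = 1 := by
    rw [← det_mul, mul_nonsing_inv _ hu, det_one]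
  have h5 : ((‖(Xᴴ * Y).det‖ ^ 2 : ℝ) : ℂ) = star (Xᴴ * Y).det * (Xᴴ * Y).det := by
    rw [RCLike.star_def, ← Complex.normSq_eq_conj_mul_self, Complex.normSq_eq_norm_sq]
  rw [h5]
  linear_combination (-(star (Xᴴ * Y).det * (Xᴴ * Y).det)) * h4

/-- The compression of a positive diagonal matrix by an isometry has determinant at most the
product of the largest diagonal entries. -/
theorem det_conjTranspose_mul_diagonal_mul_le {V : Matrix m κ ℂ} (hV : Vᴴ * V = 1)
    {d : m → ℝ} (hd : ∀ i, 0 < d i) {J : Finset m} (hJ : J.card = Fintype.card κ)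
    {t : ℝ} (ht : 0 < t) (h1 : ∀ i ∈ J, t ≤ d i) (h2 : ∀ i ∉ J, d i ≤ t) :
    (Vᴴ * diagonal (fun i => (d i : ℂ)) * V).det ≤ ((∏ i ∈ J, d i : ℝ) : ℂ) := by
  -- `t (1 + z)` dominates `d`, with equality on `J`, and equals `t` off `J`; hence `t ^ |J| ∏ (1 +
  -- z i)` is exactly the product of `d` over `J`.
  let z : m → ℝ := fun i => if i ∈ J then d i / t - 1 else 0
  have hz : ∀ i, 0 ≤ z i := by
    intro i
    by_cases hi : i ∈ J
    · simp only [z, hi, if_true, sub_nonneg]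
      rw [le_div_iff₀ ht]; linarith [h1 i hi]
    · simp [z, hi]
  have hdz : ∀ i, d i ≤ t * (1 + z i) := by
    intro i
    by_cases hi : i ∈ J
    · simp only [z, hi, if_true]; field_simp; simp
    · simpa [z, hi] using h2 i hi
  let Z : Matrix m m ℂ := diagonal (fun i => ((Real.sqrt (z i) : ℝ) : ℂ))
  have hZZ : Zᴴ * Z = diagonal (fun i => (z i : ℂ)) := by
    simp only [Z, diagonal_conjTranspose, diagonal_mul_diagonal]
    congr 1; ext i
    simp only [Pi.star_apply, RCLike.star_def, Complex.conj_ofReal]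
    rw [← Complex.ofReal_mul, Real.mul_self_sqrt (hz i)]
  have hZh : Zᴴ = Z := by
    simp only [Z, diagonal_conjTranspose]
    congr 1; ext i; simp
  have hVV : (1 - V * Vᴴ).PosSemidef := by
    have h : (1 - V * Vᴴ) = (1 - V * Vᴴ)ᴴ * (1 - V * Vᴴ) := by
      have : V * Vᴴ * (V * Vᴴ) = V * Vᴴ := by
        rw [Matrix.mul_assoc, ← Matrix.mul_assoc Vᴴ, hV, Matrix.one_mul]
      simp only [conjTranspose_sub, conjTranspose_one, conjTranspose_mul,
        conjTranspose_conjTranspose, sub_mul, mul_sub, one_mul, mul_one, this]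
      simp
    rw [h]; exact posSemidef_conjTranspose_mul_self _
  have hA : (Vᴴ * diagonal (fun i => (d i : ℂ)) * V).PosSemidef :=
    (posSemidef_diagonal_ofReal fun i => (hd i).le).conjTranspose_mul_mul_same V
  have hstep1 : (Vᴴ * diagonal (fun i => (d i : ℂ)) * V).det ≤
      ((t : ℂ) • (1 + (Z * V)ᴴ * (Z * V))).det := by
    apply hA.det_le_det
    have : (t : ℂ) • (1 + (Z * V)ᴴ * (Z * V)) - Vᴴ * diagonal (fun i => (d i : ℂ)) * V =
        Vᴴ * diagonal (fun i => ((t * (1 + z i) - d i : ℝ) : ℂ)) * V := by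
      have e : diagonal (fun i => ((t * (1 + z i) - d i : ℝ) : ℂ)) =
          (t : ℂ) • (1 + Zᴴ * Z) - diagonal (fun i => (d i : ℂ)) := by
        rw [hZZ, ← diagonal_one, diagonal_add, ← diagonal_smul, diagonal_sub]
        congr 1; ext i; simp
      rw [e, Matrix.mul_sub, Matrix.sub_mul, Matrix.mul_smul, Matrix.smul_mul, Matrix.mul_add,
        Matrix.add_mul, Matrix.mul_one, hV, conjTranspose_mul]
      simp only [Matrix.mul_assoc]
    rw [this]
    exact (posSemidef_diagonal_ofReal fun i => sub_nonneg.2 (hdz i)).conjTranspose_mul_mul_same V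
  -- Sylvester's identity moves `V` inside as `V Vᴴ ≤ 1`, which can then be dropped.
  have hstep2 : (1 + (Z * V)ᴴ * (Z * V)).det ≤ ((∏ i, (1 + z i) : ℝ) : ℂ) := by
    rw [det_one_add_mul_comm]
    have h0 : (1 + Z * V * (Z * V)ᴴ).PosSemidef :=
      PosSemidef.one.add (posSemidef_self_mul_conjTranspose _)
    refine (h0.det_le_det (B := 1 + Zᴴ * Z) ?_).trans (le_of_eq ?_)
    · have : 1 + Zᴴ * Z - (1 + Z * V * (Z * V)ᴴ) = Z * (1 - V * Vᴴ) * Zᴴ := by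
        rw [conjTranspose_mul, hZh, mul_sub, sub_mul, mul_one]
        simp only [Matrix.mul_assoc]; abel
      rw [this]; exact hVV.mul_mul_conjTranspose_same Z
    · rw [hZZ, ← diagonal_one, diagonal_add, det_diagonal]; push_cast; rfl
  have hprod : t ^ Fintype.card κ * ∏ i, (1 + z i) = ∏ i ∈ J, d i := by
    have : ∏ i, (1 + z i) = ∏ i ∈ J, (d i / t) := by
      rw [← Finset.prod_subset (Finset.subset_univ J)]
      · exact Finset.prod_congr rfl fun i hi => by simp [z, hi]
      · intro i _ hi; simp [z, hi]
    rw [this, Finset.prod_div_distrib, Finset.prod_const, hJ]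
    field_simp
  refine hstep1.trans ?_
  rw [det_smul, ← hprod, Complex.ofReal_mul, Complex.ofReal_pow]
  exact mul_le_mul_of_nonneg_left hstep2 (by exact_mod_cast pow_nonneg ht.le _)

/-- A multiplicative majorization of Horn type for the values `σ` diagonalizing `Xᴴ * Y`. -/
theorem prod_le_prod_of_conjTranspose_mul_eq_diagonal {X Y : Matrix p m ℂ} {σ d : m → ℝ}
    {W₁ W₂ : Matrix m m ℂ} (hW₁ : W₁ ∈ unitaryGroup m ℂ) (hW₂ : W₂ ∈ unitaryGroup m ℂ)
    (hXY : Xᴴ * Y = diagonal (fun i => (σ i : ℂ)))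
    (hX : Xᴴ * X = W₁ᴴ * diagonal (fun i => (d i : ℂ)) * W₁)
    (hY : Yᴴ * Y = W₂ᴴ * diagonal (fun i => (d i : ℂ)) * W₂)
    (hσ : ∀ i, 0 ≤ σ i) (hd : ∀ i, 0 < d i) {I J : Finset m} (hIJ : J.card = I.card)
    {t : ℝ} (ht : 0 < t) (h1 : ∀ i ∈ J, t ≤ d i) (h2 : ∀ i ∉ J, d i ≤ t) :
    ∏ i ∈ I, σ i ≤ ∏ i ∈ J, d i := by
  -- Keeping only the columns in `I` makes the determinant of `Xᴴ Y` the product of `σ` over `I`,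
  -- and turns the unitaries `W₁`, `W₂` into isometries.
  let s : I → m := Subtype.val
  have hs : Function.Injective s := Subtype.val_injective
  have hcard : J.card = Fintype.card I := by simpa using hIJ
  have hsub : ∀ M N : Matrix p m ℂ, (M.submatrix id s)ᴴ * N.submatrix id s =
      (Mᴴ * N).submatrix s s := by
    intro M N
    ext i j; simp [mul_apply]
  have hiso : ∀ W ∈ unitaryGroup m ℂ, (W.submatrix id s)ᴴ * W.submatrix id s = 1 := by
    intro W hW
    have h : Wᴴ * W = 1 := mem_unitaryGroup_iff'.1 hW
    have : (W.submatrix id s)ᴴ * W.submatrix id s = (Wᴴ * W).submatrix s s := by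
      ext i j; simp [mul_apply]
    rw [this, h, submatrix_one _ hs]
  have hcomp : ∀ W : Matrix m m ℂ, (Wᴴ * diagonal (fun i => (d i : ℂ)) * W).submatrix s s =
      (W.submatrix id s)ᴴ * diagonal (fun i => (d i : ℂ)) * W.submatrix id s := by
    intro W; ext i j; simp [mul_apply]
  have hdiag : (Xᴴ * Y).submatrix s s = diagonal (fun i : I => (σ i : ℂ)) := by
    rw [hXY, submatrix_diagonal _ _ hs]; rfl
  have hpos : ((X.submatrix id s)ᴴ * X.submatrix id s).PosDef := by
    rw [hsub, hX]
    refine PosDef.submatrix ?_ hs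
    have hu : IsUnit W₁ := (Unitary.isUnit_coe (U := ⟨W₁, hW₁⟩))
    rw [← star_eq_conjTranspose, IsUnit.posDef_star_left_conjugate_iff hu]
    exact PosDef.diagonal fun i => by exact_mod_cast hd i
  have key := norm_det_conjTranspose_mul_sq_le (Y := Y.submatrix id s) hpos
  rw [hsub, hsub, hsub, hdiag, hX, hY, hcomp, hcomp, det_diagonal] at key
  have k1 := det_conjTranspose_mul_diagonal_mul_le (hiso W₁ hW₁) hd hcard ht h1 h2
  have k2 := det_conjTranspose_mul_diagonal_mul_le (hiso W₂ hW₂) hd hcard ht h1 h2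
  have hn : (0 : ℂ) ≤ ((W₂.submatrix id s)ᴴ * diagonal (fun i => (d i : ℂ)) *
      W₂.submatrix id s).det :=
    ((posSemidef_diagonal_ofReal fun i => (hd i).le).conjTranspose_mul_mul_same _).det_nonneg
  have hJ0 : 0 ≤ ∏ i ∈ J, d i := Finset.prod_nonneg fun i _ => (hd i).le
  have k3 := key.trans (mul_le_mul k1 k2 hn (by exact_mod_cast hJ0))
  have hprod : ‖∏ i : I, (σ i : ℂ)‖ = ∏ i ∈ I, σ i := by
    rw [norm_prod, ← Finset.prod_coe_sort I σ]
    exact Finset.prod_congr rfl fun i _ => by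
      rw [Complex.norm_real, Real.norm_of_nonneg (hσ _)]
  rw [hprod, ← Complex.ofReal_mul, Complex.real_le_real, ← sq] at k3
  exact (sq_le_sq₀ (Finset.prod_nonneg fun i _ => hσ i) hJ0).1 k3

end Matrix

end

/-! ### Singular values and functional calculus in diagonal form. -/

section
open scoped ComplexOrder

namespace Matrix

variable {m : Type*} [Fintype m] [DecidableEq m]

/-- The columns of `Y` are orthogonal with norms `|σ j|`. The nonzero ones, divided by `σ j`, extend
to an orthonormal basis; the added vectors are multiplied by zero. -/
theorem exists_eq_unitary_mul_diagonal {Y : Matrix m m ℂ} {σ : m → ℝ}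
    (hY : Yᴴ * Y = diagonal (fun i => ((σ i ^ 2 : ℝ) : ℂ))) :
    ∃ V ∈ unitaryGroup m ℂ, Y = V * diagonal (fun i => (σ i : ℂ)) := by
  have hent : ∀ i j, ∑ k, star (Y k i) * Y k j = if i = j then ((σ i ^ 2 : ℝ) : ℂ) else 0 := by
    intro i j
    have := congrFun (congrFun hY i) j
    simpa [mul_apply, diagonal_apply] using this
  let v : m → EuclideanSpace ℂ m := fun j => WithLp.toLp 2 fun i => Y i j / (σ j : ℂ)
  have hv : Orthonormal ℂ (Set.domRestrict {j | σ j ≠ 0} v) := by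
    rw [orthonormal_iff_ite]
    rintro ⟨i, hi⟩ ⟨j, hj⟩
    have hi' : (σ i : ℂ) ≠ 0 := by exact_mod_cast hi
    have hj' : (σ j : ℂ) ≠ 0 := by exact_mod_cast hj
    have h1 : inner ℂ (v i) (v j) = (∑ k, star (Y k i) * Y k j) / (σ i * σ j) := by
      rw [PiLp.inner_apply, Finset.sum_div]
      refine Finset.sum_congr rfl fun k _ => ?_
      simp only [v, RCLike.inner_apply, map_div₀, Complex.conj_ofReal, RCLike.star_def]
      field_simp
    simp only [Set.domRestrict_apply, Subtype.mk.injEq]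
    rw [h1, hent]
    split_ifs with h
    · subst h; push_cast; field_simp
    · simp
  obtain ⟨b, hb⟩ := hv.exists_orthonormalBasis_extension_of_card_eq (by simp)
  refine ⟨of fun i j => b j i, ?_, ?_⟩
  · rw [mem_unitaryGroup_iff']
    ext i j
    have := orthonormal_iff_ite.1 b.orthonormal i j
    rw [PiLp.inner_apply] at this
    rw [one_apply, ← this, mul_apply]
    refine Finset.sum_congr rfl fun k _ => ?_
    simp [star_apply, mul_comm]
  · ext i j
    rw [mul_diagonal, of_apply]
    by_cases hj : σ j = 0
    · have h0 := hent j j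
      simp only [hj, if_true] at h0
      have h1 : ∑ k, Complex.normSq (Y k j) = 0 := by
        have : ((∑ k, Complex.normSq (Y k j) : ℝ) : ℂ) = 0 := by
          rw [Complex.ofReal_sum, ← (show _ = (0 : ℂ) by simpa using h0)]
          exact Finset.sum_congr rfl fun k _ => by
            rw [Complex.normSq_eq_conj_mul_self]
        exact_mod_cast this
      have h2 := (Finset.sum_eq_zero_iff_of_nonneg fun k _ => Complex.normSq_nonneg _).1 h1 i
        (Finset.mem_univ i)
      rw [Complex.normSq_eq_zero.1 h2, hj]; simp
    · rw [hb j hj]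
      have hj' : (σ j : ℂ) ≠ 0 := by exact_mod_cast hj
      simp [v, hj']

/-- The singular value decomposition of a complex square matrix. -/
theorem exists_singular_value_decomposition (A : Matrix m m ℂ) :
    ∃ V ∈ unitaryGroup m ℂ, ∃ Q ∈ unitaryGroup m ℂ, ∃ σ : m → ℝ, (∀ i, 0 ≤ σ i) ∧
      A = V * diagonal (fun i => (σ i : ℂ)) * Qᴴ := by
  have hA : (Aᴴ * A).PosSemidef := posSemidef_conjTranspose_mul_self A
  obtain ⟨U, hUm, l, hl, hs⟩ : ∃ U ∈ unitaryGroup m ℂ, ∃ l : m → ℝ, (∀ i, 0 ≤ l i) ∧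
      Aᴴ * A = U * diagonal (fun i => (l i : ℂ)) * Uᴴ :=
    ⟨_, hA.1.eigenvectorUnitary.2, hA.1.eigenvalues, hA.eigenvalues_nonneg,
      hA.1.spectral_theorem⟩
  have hU : Uᴴ * U = 1 := mem_unitaryGroup_iff'.1 hUm
  have hU' : U * Uᴴ = 1 := mem_unitaryGroup_iff.1 hUm
  have hY : (A * U)ᴴ * (A * U) = diagonal (fun i => ((Real.sqrt (l i) ^ 2 : ℝ) : ℂ)) := by
    rw [conjTranspose_mul, mul_assoc, ← mul_assoc Aᴴ, hs]
    simp only [mul_assoc, hU, mul_one]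
    rw [← mul_assoc, hU, one_mul]
    simp only [Real.sq_sqrt (hl _)]
  obtain ⟨V, hV, h⟩ := exists_eq_unitary_mul_diagonal hY
  exact ⟨V, hV, U, hUm, _, fun i => Real.sqrt_nonneg _, by rw [← h, mul_assoc, hU', mul_one]⟩

/-- The spectrum is finite, so `f` agrees on it with a Lagrange interpolant, and polynomials commute
with conjugation. -/
theorem cfc_conj_diagonal {U : Matrix m m ℂ} (hU : U ∈ unitaryGroup m ℂ) (d : m → ℝ)
    (f : ℝ → ℝ) : cfc f (U * diagonal (fun i => (d i : ℂ)) * Uᴴ) =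
      U * diagonal (fun i => (f (d i) : ℂ)) * Uᴴ := by
  have h1 : Uᴴ * U = 1 := mem_unitaryGroup_iff'.1 hU
  have h2 : U * Uᴴ = 1 := mem_unitaryGroup_iff.1 hU
  set M := U * diagonal (fun i => (d i : ℂ)) * Uᴴ with hM
  have hsa : IsSelfAdjoint M := by
    have : (diagonal fun i => (d i : ℂ))ᴴ = diagonal fun i => (d i : ℂ) := by
      rw [diagonal_conjTranspose]; congr 1; ext i; simp
    rw [isSelfAdjoint_iff, star_eq_conjTranspose, hM, conjTranspose_mul, conjTranspose_mul, this,
      conjTranspose_conjTranspose, mul_assoc]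
  have hspec : ∀ x ∈ spectrum ℝ M, ∃ i, d i = x := by
    intro x hx
    have hx' : (x : ℂ) ∈ spectrum ℂ M := spectrum.algebraMap_mem ℂ hx
    have e : M = ((⟨U, hU⟩ : unitary (Matrix m m ℂ)) : Matrix m m ℂ) *
      diagonal (fun i => (d i : ℂ)) * star ((⟨U, hU⟩ : unitary (Matrix m m ℂ)) : Matrix m m ℂ) := rfl
    rw [e, Unitary.spectrum_star_right_conjugate, spectrum_diagonal] at hx'
    obtain ⟨i, hi⟩ := hx'
    exact ⟨i, Complex.ofReal_injective hi⟩
  have hpoly : ∀ q : Polynomial ℝ, Polynomial.aeval M q =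
      U * diagonal (fun i => ((q.eval (d i) : ℝ) : ℂ)) * Uᴴ := by
    intro q
    have hpow : ∀ k : ℕ, M ^ k = U * diagonal (fun i => (((d i) ^ k : ℝ) : ℂ)) * Uᴴ := by
      intro k
      induction k with
      | zero => simp [h2]
      | succ k ih =>
        rw [pow_succ, ih, hM]
        have : ∀ D E : Matrix m m ℂ, U * D * Uᴴ * (U * E * Uᴴ) = U * (D * E) * Uᴴ := by
          intro D E
          calc U * D * Uᴴ * (U * E * Uᴴ) = U * D * (Uᴴ * U) * E * Uᴴ := by
                simp only [mul_assoc]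
            _ = _ := by rw [h1, mul_one]; simp only [mul_assoc]
        rw [this, diagonal_mul_diagonal]
        simp [pow_succ]
    induction q using Polynomial.induction_on' with
    | add p q hp hq =>
      rw [map_add, hp, hq, ← add_mul, ← mul_add, diagonal_add]
      simp
    | monomial k a =>
      rw [Polynomial.aeval_monomial, hpow, ← Algebra.smul_def]
      simp only [Polynomial.eval_monomial]
      rw [← smul_mul_assoc, ← mul_smul_comm, ← diagonal_smul]
      congr 3
      ext i
      simp
  let q := Lagrange.interpolate (Finset.univ.image d) id f
  have hq : ∀ i, q.eval (d i) = f (d i) := fun i =>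
    Lagrange.eval_interpolate_at_node (v := id) f (Function.injective_id.injOn)
      (Finset.mem_image_of_mem d (Finset.mem_univ i))
  have hcongr : (spectrum ℝ M).EqOn f q.eval := by
    intro x hx
    obtain ⟨i, rfl⟩ := hspec x hx
    exact (hq i).symm
  rw [cfc_congr hcongr, cfc_polynomial q M hsa, hpoly]
  simp only [hq]

theorem conj_diagonal_nonneg (U : Matrix m m ℂ) {x : m → ℝ} (hx : ∀ i, 0 ≤ x i) :
    0 ≤ U * diagonal (fun i => (x i : ℂ)) * Uᴴ :=
  nonneg_iff_posSemidef.2 ((posSemidef_diagonal_ofReal hx).mul_mul_conjTranspose_same U)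

theorem abs_eq_of_singular_value_decomposition {V Q : Matrix m m ℂ} (hV : V ∈ unitaryGroup m ℂ)
    (hQ : Q ∈ unitaryGroup m ℂ) {σ : m → ℝ} (hσ : ∀ i, 0 ≤ σ i) :
    CFC.abs (V * diagonal (fun i => (σ i : ℂ)) * Qᴴ) =
      Q * diagonal (fun i => (σ i : ℂ)) * Qᴴ := by
  have h1 : Vᴴ * V = 1 := mem_unitaryGroup_iff'.1 hV
  have h2 : Qᴴ * Q = 1 := mem_unitaryGroup_iff'.1 hQ
  have hd : (diagonal fun i => (σ i : ℂ))ᴴ = diagonal fun i => (σ i : ℂ) := by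
    rw [diagonal_conjTranspose]; congr 1; ext i; simp
  refine CFC.sqrt_unique ?_ ?_
  · rw [star_eq_conjTranspose, conjTranspose_mul, conjTranspose_mul, hd,
      conjTranspose_conjTranspose]
    generalize (diagonal fun i => (σ i : ℂ)) = D
    calc Q * D * Qᴴ * (Q * D * Qᴴ) = Q * D * (Qᴴ * Q) * D * Qᴴ := by simp only [mul_assoc]
      _ = Q * D * (Vᴴ * V) * D * Qᴴ := by rw [h1, h2]
      _ = _ := by simp only [mul_assoc]
  · exact conj_diagonal_nonneg Q hσ

end Matrix

end

/-! ### Convexity and rearrangement of real sequences. -/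

section
open Matrix

theorem ConcaveOn.monotoneOn_of_nonneg {f : ℝ → ℝ} (hf : ConcaveOn ℝ (Set.Ici 0) f)
    (h0 : ∀ t : ℝ, 0 ≤ t → 0 ≤ f t) : MonotoneOn f (Set.Ici 0) := by
  intro x hx y hy hxy
  by_contra! hlt
  have hxy' : x < y := lt_of_le_of_ne hxy fun h => by subst h; exact lt_irrefl _ hlt
  have hx0 : 0 ≤ x := hx
  have hfx : 0 < f x := (h0 y hy).trans_lt hlt
  -- At `z` the line through the graph points over `x` and `y` has the negative value `f y - f x`,
  -- and concavity keeps `f z` below it.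
  set z := y + f x * (y - x) / (f x - f y) with hz
  have hd : 0 < f x - f y := sub_pos.2 hlt
  have hyz : y < z := by
    have : 0 < f x * (y - x) / (f x - f y) := div_pos (mul_pos hfx (sub_pos.2 hxy')) hd
    linarith
  have hs := hf.slope_anti_adjacent hx (show z ∈ Set.Ici 0 from (hx0.trans hxy).trans hyz.le)
    hxy' hyz
  have hz0 := h0 z ((hx0.trans hxy).trans hyz.le)
  have hzy : (z - y) * (f x - f y) = f x * (y - x) := by
    rw [hz]; field_simp; ring
  rw [div_le_div_iff₀ (sub_pos.2 hyz) (sub_pos.2 hxy')] at hs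
  have h1 : 0 ≤ f z * (y - x) := mul_nonneg hz0 (sub_pos.2 hxy').le
  have h2 : 0 < (f x - f y) * (y - x) := mul_pos hd (sub_pos.2 hxy')
  linarith

theorem ConcaveOn.map_add_le {f : ℝ → ℝ} (hf : ConcaveOn ℝ (Set.Ici 0) f)
    (h0 : 0 ≤ f 0) {x y : ℝ} (hx : 0 ≤ x) (hy : 0 ≤ y) : f (x + y) ≤ f x + f y := by
  rcases hx.eq_or_lt with rfl | hx'
  · simpa using h0
  have hs : 0 < x + y := by linarith
  have h1 := hf.2 (show (0 : ℝ) ∈ Set.Ici 0 from Set.mem_Ici.2 le_rfl) (show x + y ∈ Set.Ici 0 from hs.le)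
    (show 0 ≤ y / (x + y) by positivity) (show 0 ≤ x / (x + y) by positivity)
    (by field_simp; ring)
  have h2 := hf.2 (show (0 : ℝ) ∈ Set.Ici 0 from Set.mem_Ici.2 le_rfl) (show x + y ∈ Set.Ici 0 from hs.le)
    (show 0 ≤ x / (x + y) by positivity) (show 0 ≤ y / (x + y) by positivity) (by field_simp)
  simp only [smul_eq_mul, mul_zero, zero_add] at h1 h2
  rw [div_mul_cancel₀ _ hs.ne'] at h1 h2
  have h3 : x / (x + y) + y / (x + y) = 1 := by field_simp
  have h4 : 0 ≤ x / (x + y) * f 0 := by positivity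
  have h5 : 0 ≤ y / (x + y) * f 0 := by positivity
  have h6 : x / (x + y) * f (x + y) + y / (x + y) * f (x + y) = f (x + y) := by
    rw [← add_mul, h3, one_mul]
  linarith

theorem ConvexOn.exists_subgradient {g : ℝ → ℝ} (hg : ConvexOn ℝ Set.univ g) (x : ℝ) :
    ∃ c, ∀ y, g x - g y ≤ c * (x - y) := by
  refine ⟨derivWithin g (Set.Ioi x) x, fun y => ?_⟩
  have hint : x ∈ interior (Set.univ : Set ℝ) := by simp
  rcases lt_trichotomy y x with h | rfl | h
  · have h1 := hg.slope_le_leftDeriv_of_mem_interior (Set.mem_univ y) hint h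
    have h2 := h1.trans (hg.leftDeriv_le_rightDeriv_of_mem_interior hint)
    rwa [slope_def_field, div_le_iff₀ (sub_pos.2 h)] at h2
  · simp
  · have h1 := hg.rightDeriv_le_slope_of_mem_interior hint (Set.mem_univ y) h
    rw [slope_def_field, le_div_iff₀ (sub_pos.2 h)] at h1
    linarith

/-- Abel summation. Partial sums are controlled only where `v k > 0`: in the application, `u`
involves logarithms that are meaningless where the weight vanishes. -/
theorem Finset.sum_range_mul_nonpos_of_antitone {v u : ℕ → ℝ} {N : ℕ} (hv : ∀ k, 0 ≤ v k)
    (hanti : ∀ k, k + 1 < N → v (k + 1) ≤ v k)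
    (hU : ∀ k < N, 0 < v k → ∑ j ∈ Finset.range (k + 1), u j ≤ 0) :
    ∑ j ∈ Finset.range N, v j * u j ≤ 0 := by
  have hU' : ∀ k < N, v k * ∑ j ∈ Finset.range (k + 1), u j ≤ 0 := by
    intro k hk
    rcases (hv k).eq_or_lt with h | h
    · rw [← h]; simp
    · exact mul_nonpos_of_nonneg_of_nonpos h.le (hU k hk h)
  have key : ∀ k < N, ∑ j ∈ Finset.range (k + 1), v j * u j ≤
      v k * ∑ j ∈ Finset.range (k + 1), u j := by
    intro k
    induction k with
    | zero => intro _; simp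
    | succ k ih =>
      intro hk
      have h1 := ih (by omega)
      rw [Finset.sum_range_succ, Finset.sum_range_succ _ (k + 1), mul_add]
      have h2 := hanti k hk
      rcases (hv k).eq_or_lt with h | h
      · have h3 : v (k + 1) = 0 := le_antisymm (h ▸ h2) (hv _)
        rw [h3]; rw [← h] at h1; linarith
      · have := mul_le_mul_of_nonpos_right h2 (hU k (by omega) h)
        linarith
  rcases N with _ | N
  · simp
  · exact (key N (by omega)).trans (hU' N (by omega))

theorem exists_equiv_fin_antitone {m : Type*} [Fintype m] (x : m → ℝ) :
    ∃ e : Fin (Fintype.card m) ≃ m, Antitone (x ∘ e) := by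
  let e₀ := (Fintype.equivFin m).symm
  refine ⟨(Tuple.sort fun i => - x (e₀ i)).trans e₀, fun i j hij => ?_⟩
  have := Tuple.monotone_sort (fun i => - x (e₀ i)) hij
  simpa using this

/-- `ρ` matches the ranks of `v` and `d` in decreasing order. No order on `σ` is needed, since the
product bound holds for every `I`, in particular for the top indices of `v`; its logarithm bounds
the partial sums in Abel summation. -/
theorem exists_perm_sum_mul_log_le {m : Type*} [Fintype m] [DecidableEq m] {σ d v : m → ℝ}
    (hv : ∀ i, 0 ≤ v i) (hvσ : ∀ i, 0 < v i → 0 < σ i) (hd : ∀ i, 0 < d i)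
    (hmaj : ∀ (I J : Finset m) (t : ℝ), J.card = I.card → 0 < t → (∀ i ∈ J, t ≤ d i) →
      (∀ i ∉ J, d i ≤ t) → ∏ i ∈ I, σ i ≤ ∏ i ∈ J, d i) :
    ∃ ρ : Equiv.Perm m, ∑ i, v i * (Real.log (σ i) - Real.log (d (ρ i))) ≤ 0 := by
  set N := Fintype.card m
  obtain ⟨e, he⟩ := exists_equiv_fin_antitone v
  obtain ⟨e', he'⟩ := exists_equiv_fin_antitone d
  refine ⟨e.symm.trans e', ?_⟩
  rw [← e.sum_comp]
  simp only [Equiv.trans_apply, Equiv.symm_apply_apply]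
  let v' : ℕ → ℝ := fun k => if h : k < N then v (e ⟨k, h⟩) else 0
  let u' : ℕ → ℝ := fun k => if h : k < N then
    Real.log (σ (e ⟨k, h⟩)) - Real.log (d (e' ⟨k, h⟩)) else 0
  have hsum : ∑ i, v (e i) * (Real.log (σ (e i)) - Real.log (d (e' i))) =
      ∑ k ∈ Finset.range N, v' k * u' k := by
    rw [Finset.sum_range]
    exact Finset.sum_congr rfl fun i _ => by simp [v', u']
  rw [hsum]
  refine Finset.sum_range_mul_nonpos_of_antitone ?_ ?_ ?_
  · intro k
    by_cases h : k < N
    · simp [v', h, hv]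
    · simp [v', h]
  · intro k hk
    have hk' : k < N := by omega
    simp only [v', hk, hk', dif_pos]
    exact he (Fin.mk_le_mk.2 (Nat.le_succ k))
  · intro k hk hvk
    let T : Finset (Fin N) := Finset.univ.filter fun i => i.1 ≤ k
    have hT : ∑ j ∈ Finset.range (k + 1), u' j =
        ∑ i ∈ T, (Real.log (σ (e i)) - Real.log (d (e' i))) := by
      symm
      refine Finset.sum_bij (fun i _ => i.1) ?_ ?_ ?_ ?_
      · intro i hi
        simp only [T, Finset.mem_filter, Finset.mem_univ, true_and] at hi
        exact Finset.mem_range.2 (by omega)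
      · intro i _ j _ h; exact Fin.ext h
      · intro j hj
        rw [Finset.mem_range] at hj
        exact ⟨⟨j, by omega⟩, by simp [T]; omega, rfl⟩
      · intro i _; simp [u']
    have hσpos : ∀ i ∈ T, 0 < σ (e i) := by
      intro i hi
      simp only [T, Finset.mem_filter, Finset.mem_univ, true_and] at hi
      apply hvσ
      have h1 : v (e ⟨k, hk⟩) ≤ v (e i) := he (show i ≤ ⟨k, hk⟩ from hi)
      simp only [v', hk, dif_pos] at hvk
      exact hvk.trans_le h1
    have hM := hmaj (T.map e.toEmbedding) (T.map e'.toEmbedding) (d (e' ⟨k, hk⟩)) (by simp)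
      (hd _) ?_ ?_
    · rw [hT, Finset.sum_sub_distrib, sub_nonpos,
        ← Real.log_prod fun i hi => (hσpos i hi).ne', ← Real.log_prod fun i _ => (hd _).ne']
      rw [Finset.prod_map, Finset.prod_map] at hM
      exact Real.log_le_log (Finset.prod_pos hσpos) hM
    · intro i hi
      obtain ⟨j, hj, rfl⟩ := Finset.mem_map.1 hi
      simp only [T, Finset.mem_filter, Finset.mem_univ, true_and] at hj
      exact he' (show j ≤ ⟨k, hk⟩ from hj)
    · intro i hi
      obtain ⟨j, rfl⟩ := e'.surjective i
      have hj : ¬ j.1 ≤ k := fun h => hi (Finset.mem_map_of_mem e'.toEmbedding (by simpa [T] using h))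
      exact he' (show (⟨k, hk⟩ : Fin N) ≤ j from (not_le.1 hj).le)

/-! ### Symmetric norms of diagonal matrices. -/

namespace SymmetricNorm

variable {m : Type*} [Fintype m] [DecidableEq m] (N : SymmetricNorm m)

theorem map_unitary_mul_mul {U V : Matrix m m ℂ} (hU : U ∈ unitaryGroup m ℂ)
    (hV : V ∈ unitaryGroup m ℂ) (X : Matrix m m ℂ) : N (U * X * V) = N X :=
  N.unitary_invariant' U hU V hV X

theorem map_diagonal_perm (x : m → ℝ) (ρ : Equiv.Perm m) :
    N (diagonal fun i => (x (ρ i) : ℂ)) = N (diagonal fun i => (x i : ℂ)) := by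
  have hP : ∀ τ : Equiv.Perm m, ((1 : Matrix m m ℂ).submatrix id τ) ∈ unitaryGroup m ℂ := by
    intro τ
    rw [mem_unitaryGroup_iff']
    rw [star_eq_conjTranspose, conjTranspose_submatrix, conjTranspose_one]
    have := submatrix_mul_equiv (1 : Matrix m m ℂ) (1 : Matrix m m ℂ) τ (Equiv.refl m) τ
    rw [Equiv.coe_refl] at this
    rw [this, mul_one, submatrix_one_equiv]
  have e : (diagonal fun i => (x (ρ i) : ℂ)) =
      ((1 : Matrix m m ℂ).submatrix id ρ)ᴴ * (diagonal fun i => (x i : ℂ)) *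
        (1 : Matrix m m ℂ).submatrix id ρ := by
    ext i j
    by_cases h : i = j <;> simp [mul_apply, diagonal_apply, one_apply, h]
  rw [e, N.map_unitary_mul_mul _ (hP ρ)]
  rw [← star_eq_conjTranspose]
  exact Unitary.star_mem (hP ρ)

theorem map_diagonal_sign (x s : m → ℝ) (hs : ∀ i, s i * s i = 1) :
    N (diagonal fun i => ((s i * x i : ℝ) : ℂ)) = N (diagonal fun i => (x i : ℂ)) := by
  have hS : (diagonal fun i => (s i : ℂ)) ∈ unitaryGroup m ℂ := by
    rw [mem_unitaryGroup_iff', star_eq_conjTranspose, diagonal_conjTranspose,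
      diagonal_mul_diagonal, ← diagonal_one]
    congr 1; ext i
    simp only [Pi.star_apply, RCLike.star_def, Complex.conj_ofReal]
    exact_mod_cast hs i
  have e : (diagonal fun i => ((s i * x i : ℝ) : ℂ)) =
      (diagonal fun i => (s i : ℂ)) * (diagonal fun i => (x i : ℂ)) * 1 := by
    rw [mul_one, diagonal_mul_diagonal]; simp
  rw [e, N.map_unitary_mul_mul hS (one_mem _)]

/-- Hahn–Banach: `a` represents a functional supporting the norm at `x`. -/
theorem exists_dual_weights (x : m → ℝ) : ∃ a : m → ℝ,
    (∑ i, a i * x i = N (diagonal fun i => (x i : ℂ))) ∧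
    ∀ y : m → ℝ, ∑ i, a i * y i ≤ N (diagonal fun i => (y i : ℂ)) := by
  let p : (m → ℝ) → ℝ := fun y => N (diagonal fun i => (y i : ℂ))
  have hsmul : ∀ (c : ℝ) (y : m → ℝ), p (c • y) = |c| * p y := by
    intro c y
    have : (diagonal fun i => ((c • y) i : ℂ)) = (c : ℂ) • (diagonal fun i => (y i : ℂ)) := by
      rw [← diagonal_smul]; congr 1; ext i; simp
    simp only [p]
    rw [this, map_smul_eq_mul, Complex.norm_real, Real.norm_eq_abs]
  have hadd : ∀ y z : m → ℝ, p (y + z) ≤ p y + p z := by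
    intro y z
    have : (diagonal fun i => ((y + z) i : ℂ)) =
        (diagonal fun i => (y i : ℂ)) + (diagonal fun i => (z i : ℂ)) := by
      rw [diagonal_add]; simp
    simp only [p]
    rw [this]
    exact map_add_le_add _ _ _
  have hp0 : ∀ y, 0 ≤ p y := fun y => apply_nonneg N.toSeminorm _
  obtain ⟨φ, hφx, hφ⟩ : ∃ φ : (m → ℝ) →ₗ[ℝ] ℝ, φ x = p x ∧ ∀ y, φ y ≤ p y := by
    by_cases hx : x = 0
    · refine ⟨0, ?_, fun y => hp0 y⟩
      have := hsmul 0 x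
      simp only [zero_smul, abs_zero, zero_mul] at this
      rw [hx, this]; rfl
    let F : (m → ℝ) →ₗ.[ℝ] ℝ := LinearPMap.mkSpanSingleton x (p x) hx
    obtain ⟨g, hg, hg'⟩ := exists_extension_of_le_sublinear F p
      (fun c hc y => by rw [hsmul, abs_of_pos hc]) hadd (by
        rintro ⟨y, hy⟩
        obtain ⟨c, rfl⟩ := Submodule.mem_span_singleton.1 hy
        rw [LinearPMap.mkSpanSingleton'_apply, hsmul, smul_eq_mul]
        exact mul_le_mul_of_nonneg_right (le_abs_self c) (hp0 x))
    refine ⟨g, ?_, hg'⟩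
    have := hg ⟨x, Submodule.mem_span_singleton_self x⟩
    rw [this]
    exact LinearPMap.mkSpanSingleton'_apply_self _ _ _ _
  have hsum : ∀ y : m → ℝ, ∑ i, φ (fun j => if i = j then 1 else 0) * y i = φ y := by
    intro y
    rw [LinearMap.pi_apply_eq_sum_univ φ y]
    exact Finset.sum_congr rfl fun i _ => mul_comm _ _
  exact ⟨_, (hsum x).trans hφx, fun y => (hsum y).trans_le (hφ y)⟩

/-- Weak log-majorization implies norm domination for e-convex monotone functions. -/
theorem map_diagonal_comp_le {σ d h : m → ℝ} {f : ℝ → ℝ} (hmono : MonotoneOn f (Set.Ici 0))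
    (hconv : EConvex f) (hf0 : ∀ t : ℝ, 0 ≤ t → 0 ≤ f t)
    (hσ : ∀ i, 0 ≤ σ i) (hd : ∀ i, 0 < d i) (hh : ∀ i, f (d i) ≤ h i)
    (hmaj : ∀ (I J : Finset m) (t : ℝ), J.card = I.card → 0 < t → (∀ i ∈ J, t ≤ d i) →
      (∀ i ∉ J, d i ≤ t) → ∏ i ∈ I, σ i ≤ ∏ i ∈ J, d i) :
    N (diagonal fun i => (f (σ i) : ℂ)) ≤ N (diagonal fun i => (h i : ℂ)) := by
  obtain ⟨a, ha, hay⟩ := N.exists_dual_weights fun i => f (σ i)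
  choose c hc using fun x => hconv.exists_subgradient x
  have hc0 : ∀ x, 0 ≤ c x := by
    intro x
    have h1 := hc x (x - 1)
    have h2 : f (Real.exp (x - 1)) ≤ f (Real.exp x) :=
      hmono (Real.exp_pos _).le (Real.exp_pos _).le (Real.exp_le_exp.2 (by linarith))
    linarith [show f (Real.exp x) - f (Real.exp (x - 1)) ≤ c x * (x - (x - 1)) from h1]
  -- The slope of `f ∘ exp` at `log σ` converts differences of `f` into differences of logarithms.
  -- Where `σ i = 0` monotonicity alone suffices, so the weight is 0.
  let v : m → ℝ := fun i => if σ i = 0 then 0 else |a i| * c (Real.log (σ i))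
  have hv : ∀ i, 0 ≤ v i := fun i => by
    simp only [v]; split_ifs
    · exact le_rfl
    · exact mul_nonneg (abs_nonneg _) (hc0 _)
  obtain ⟨ρ, hρ⟩ := exists_perm_sum_mul_log_le (σ := σ) (d := d) hv
    (fun i hi => (hσ i).lt_of_ne fun h0 => by simp [v, ← h0] at hi) hd hmaj
  have hterm : ∀ i, |a i| * (f (σ i) - f (d (ρ i))) ≤
      v i * (Real.log (σ i) - Real.log (d (ρ i))) := by
    intro i
    by_cases h0 : σ i = 0
    · simp only [v, h0, if_true, zero_mul]
      refine mul_nonpos_of_nonneg_of_nonpos (abs_nonneg _) (sub_nonpos.2 ?_)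
      exact hmono (Set.mem_Ici.2 le_rfl) (hd _).le (hd _).le
    · have hpos : 0 < σ i := (hσ i).lt_of_ne (Ne.symm h0)
      have := hc (Real.log (σ i)) (Real.log (d (ρ i)))
      simp only [Real.exp_log hpos, Real.exp_log (hd _)] at this
      simp only [v, h0, if_false, mul_assoc]
      exact mul_le_mul_of_nonneg_left this (abs_nonneg _)
  -- Signs turn `|a|` back into `a`, so the dual bound applies without changing the norm.
  let s : m → ℝ := fun i => if 0 ≤ a i then 1 else -1
  have hs : ∀ i, s i * s i = 1 := fun i => by simp only [s]; split_ifs <;> norm_num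
  have has : ∀ i, a i * s i = |a i| := fun i => by
    simp only [s]; split_ifs with h
    · rw [abs_of_nonneg h, mul_one]
    · rw [abs_of_neg (not_le.1 h)]; ring
  calc N (diagonal fun i => (f (σ i) : ℂ)) = ∑ i, a i * f (σ i) := ha.symm
    _ ≤ ∑ i, |a i| * f (σ i) := Finset.sum_le_sum fun i _ =>
        mul_le_mul_of_nonneg_right (le_abs_self _) (hf0 _ (hσ i))
    _ ≤ ∑ i, |a i| * f (d (ρ i)) := by
        have := (Finset.sum_le_sum fun i _ => hterm i).trans hρ
        simp only [mul_sub, Finset.sum_sub_distrib] at this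
        linarith
    _ ≤ ∑ i, |a i| * h (ρ i) := Finset.sum_le_sum fun i _ =>
        mul_le_mul_of_nonneg_left (hh _) (abs_nonneg _)
    _ = ∑ i, a i * (s i * h (ρ i)) := Finset.sum_congr rfl fun i _ => by
        rw [← mul_assoc, has]
    _ ≤ N (diagonal fun i => ((s i * h (ρ i) : ℝ) : ℂ)) := hay _
    _ = N (diagonal fun i => (h i : ℂ)) := by
        rw [N.map_diagonal_sign (fun i => h (ρ i)) s hs, N.map_diagonal_perm h ρ]

end SymmetricNorm

end

/-! ### Unitary perturbations and block matrices. -/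

section
open Matrix

namespace SymmetricNorm

theorem map_unitary_mul_diagonal_mul {m : Type*} [Fintype m] [DecidableEq m]
    (N : SymmetricNorm m) {U : Matrix m m ℂ} (hU : U ∈ unitaryGroup m ℂ) (X : Matrix m m ℂ) :
    N (U * X * Uᴴ) = N X :=
  N.map_unitary_mul_mul hU (Unitary.star_mem hU) X

/-- A norm bound for a unitary perturbation of a matrix with singular values `e`. -/
theorem map_cfc_abs_add_unitary_le {m : Type*} [Fintype m] [DecidableEq m]
    (N : SymmetricNorm m) {f : ℝ → ℝ} (hmono : MonotoneOn f (Set.Ici 0))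
    (hconv : EConvex f) (hf0 : ∀ t : ℝ, 0 ≤ t → 0 ≤ f t) {e h : m → ℝ} (he : ∀ i, 0 ≤ e i)
    (hh : ∀ i, f (e i + 1) ≤ h i) {Z₁ Z₂ Γ : Matrix m m ℂ} (hZ₁ : Z₁ ∈ unitaryGroup m ℂ)
    (hZ₂ : Z₂ ∈ unitaryGroup m ℂ) (hΓ : Γ ∈ unitaryGroup m ℂ) :
    N (cfc f (CFC.abs (Z₁ * diagonal (fun i => (e i : ℂ)) * Z₂ᴴ + Γ))) ≤
      N (diagonal fun i => (h i : ℂ)) := by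
  obtain ⟨V, hV, Q, hQ, σ, hσ, hS⟩ := exists_singular_value_decomposition
    (Z₁ * diagonal (fun i => (e i : ℂ)) * Z₂ᴴ + Γ)
  have hSV : Vᴴ * (Z₁ * diagonal (fun i => (e i : ℂ)) * Z₂ᴴ + Γ) * Q =
      diagonal (fun i => (σ i : ℂ)) := by
    have h1 : Vᴴ * V = 1 := mem_unitaryGroup_iff'.1 hV
    have h2 : Qᴴ * Q = 1 := mem_unitaryGroup_iff'.1 hQ
    rw [hS]
    calc Vᴴ * (V * diagonal (fun i => (σ i : ℂ)) * Qᴴ) * Q =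
        (Vᴴ * V) * diagonal (fun i => (σ i : ℂ)) * (Qᴴ * Q) := by simp only [mul_assoc]
      _ = _ := by rw [h1, h2, one_mul, mul_one]
  rw [hS, abs_eq_of_singular_value_decomposition hV hQ hσ, cfc_conj_diagonal hQ,
    N.map_unitary_mul_diagonal_mul hQ]
  refine N.map_diagonal_comp_le (d := fun i => e i + 1) hmono hconv hf0 hσ
    (fun i => by linarith [he i]) hh ?_
  intro I J t hIJ ht h1 h2
  -- The square root splits `e` evenly between the two factors: stacking `E Z₁ᴴ` over `1` and `E
  -- Z₂ᴴ` over `Γ` gives factors with product `Z₁ E² Z₂ᴴ + Γ` and both Gram matrices similar to `E²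
  -- + 1`.
  let E : Matrix m m ℂ := diagonal fun i => ((Real.sqrt (e i) : ℝ) : ℂ)
  have hEh : Eᴴ = E := by
    simp only [E, diagonal_conjTranspose]; congr 1; ext i; simp
  have hEE : E * E = diagonal fun i => (e i : ℂ) := by
    simp only [E, diagonal_mul_diagonal]
    congr 1; ext i
    rw [← Complex.ofReal_mul, Real.mul_self_sqrt (he i)]
  have hd : (diagonal fun i => ((e i + 1 : ℝ) : ℂ)) = E * E + 1 := by
    rw [hEE, ← diagonal_one, diagonal_add]; simp
  have gram : ∀ Z W T : Matrix m m ℂ, Z ∈ unitaryGroup m ℂ → W ∈ unitaryGroup m ℂ →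
      T ∈ unitaryGroup m ℂ → (fromRows (E * (Zᴴ * W)) (T * W))ᴴ *
        fromRows (E * (Zᴴ * W)) (T * W) =
      (Zᴴ * W)ᴴ * diagonal (fun i => ((e i + 1 : ℝ) : ℂ)) * (Zᴴ * W) := by
    intro Z W T hZ hW hT
    have hT' : Tᴴ * T = 1 := mem_unitaryGroup_iff'.1 hT
    have hZ' : Z * Zᴴ = 1 := mem_unitaryGroup_iff.1 hZ
    rw [conjTranspose_fromRows_eq_fromCols_conjTranspose, fromCols_mul_fromRows, hd]
    simp only [conjTranspose_mul, conjTranspose_conjTranspose, hEh]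
    have e1 : Wᴴ * Tᴴ * (T * W) = Wᴴ * W := by
      rw [mul_assoc, ← mul_assoc Tᴴ, hT', one_mul]
    have e2 : Wᴴ * Z * 1 * (Zᴴ * W) = Wᴴ * W := by
      rw [mul_one, mul_assoc, ← mul_assoc Z, hZ', one_mul]
    rw [e1, mul_add, add_mul, e2]
    simp only [mul_assoc]
  refine prod_le_prod_of_conjTranspose_mul_eq_diagonal
    (X := fromRows (E * (Z₁ᴴ * V)) (1 * V)) (Y := fromRows (E * (Z₂ᴴ * Q)) (Γ * Q))
    (W₁ := Z₁ᴴ * V) (W₂ := Z₂ᴴ * Q) (mul_mem (Unitary.star_mem hZ₁) hV)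
    (mul_mem (Unitary.star_mem hZ₂) hQ) ?_ (gram Z₁ V 1 hZ₁ hV (one_mem _))
    (gram Z₂ Q Γ hZ₂ hQ hΓ) hσ (fun i => by linarith [he i]) hIJ ht h1 h2
  rw [← hSV, ← hEE, conjTranspose_fromRows_eq_fromCols_conjTranspose, fromCols_mul_fromRows]
  simp only [conjTranspose_mul, conjTranspose_conjTranspose, hEh, one_mul, mul_add, add_mul,
    mul_assoc]

variable {n : Type*} [Fintype n] [DecidableEq n]

theorem _root_.Matrix.fromBlocks_diagonal_mem_unitaryGroup {U V : Matrix n n ℂ}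
    (hU : U ∈ unitaryGroup n ℂ) (hV : V ∈ unitaryGroup n ℂ) :
    fromBlocks U 0 0 V ∈ unitaryGroup (n ⊕ n) ℂ := by
  rw [mem_unitaryGroup_iff, star_eq_conjTranspose] at *
  simp [fromBlocks_conjTranspose, fromBlocks_multiply, hU, hV]

/-- Both products are unitarily similar to the diagonal matrix of squared singular values. -/
theorem map_mul_conjTranspose_self {m : Type*} [Fintype m] [DecidableEq m]
    (N : SymmetricNorm m) (C : Matrix m m ℂ) : N (C * Cᴴ) = N (Cᴴ * C) := by
  obtain ⟨V, hV, Q, hQ, σ, hσ, rfl⟩ := exists_singular_value_decomposition C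
  have h1 : Vᴴ * V = 1 := mem_unitaryGroup_iff'.1 hV
  have h2 : Qᴴ * Q = 1 := mem_unitaryGroup_iff'.1 hQ
  have hd : (diagonal fun i => (σ i : ℂ))ᴴ = diagonal fun i => (σ i : ℂ) := by
    rw [diagonal_conjTranspose]; congr 1; ext i; simp
  simp only [conjTranspose_mul, hd, conjTranspose_conjTranspose]
  generalize (diagonal fun i => (σ i : ℂ)) = D
  have e1 : V * D * Qᴴ * (Q * (D * Vᴴ)) = V * (D * D) * Vᴴ := by
    calc _ = V * D * (Qᴴ * Q) * D * Vᴴ := by simp only [mul_assoc]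
      _ = _ := by rw [h2, mul_one]; simp only [mul_assoc]
  have e2 : Q * (D * Vᴴ) * (V * D * Qᴴ) = Q * (D * D) * Qᴴ := by
    calc _ = Q * D * (Vᴴ * V) * D * Qᴴ := by simp only [mul_assoc]
      _ = _ := by rw [h1, mul_one]; simp only [mul_assoc]
  rw [e1, e2, N.map_unitary_mul_diagonal_mul hV, N.map_unitary_mul_diagonal_mul hQ]

/-- The block diagonal part is the average of the matrix and its conjugate by `1 ⊕ (-1)`. -/
theorem map_pinching_le (N : SymmetricNorm (n ⊕ n)) (A B C D : Matrix n n ℂ) :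
    N (fromBlocks A 0 0 D) ≤ N (fromBlocks A B C D) := by
  have hJ : fromBlocks 1 0 0 (-1 : Matrix n n ℂ) ∈ unitaryGroup (n ⊕ n) ℂ :=
    fromBlocks_diagonal_mem_unitaryGroup (one_mem _)
      (by rw [mem_unitaryGroup_iff, star_neg, star_one]; simp)
  have h1 := N.map_unitary_mul_mul hJ hJ (fromBlocks A B C D)
  have h2 : (2 : ℂ) • fromBlocks A 0 0 D = fromBlocks A B C D +
      fromBlocks 1 0 0 (-1 : Matrix n n ℂ) * fromBlocks A B C D * fromBlocks 1 0 0 (-1) := by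
    simp [fromBlocks_multiply, fromBlocks_add, two_smul]
  have h3 := map_add_le_add N.toSeminorm (fromBlocks A B C D)
    (fromBlocks 1 0 0 (-1 : Matrix n n ℂ) * fromBlocks A B C D * fromBlocks 1 0 0 (-1))
  rw [h1, ← h2, map_smul_eq_mul] at h3
  norm_num at h3
  linarith

/-- For `C` with first block column `√X`, `√Y` and second column zero, `Cᴴ C = (X + Y) ⊕ 0`, while
`C Cᴴ` has diagonal blocks `X` and `Y`. -/
theorem map_fromBlocks_le_restrict_add (N : SymmetricNorm (n ⊕ n)) {X Y : Matrix n n ℂ}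
    (hX : 0 ≤ X) (hY : 0 ≤ Y) : N (fromBlocks X 0 0 Y) ≤ N.restrict (X + Y) := by
  have hRh : (CFC.sqrt X)ᴴ = CFC.sqrt X :=
    (CFC.sqrt_nonneg X).isSelfAdjoint.star_eq
  have hTh : (CFC.sqrt Y)ᴴ = CFC.sqrt Y :=
    (CFC.sqrt_nonneg Y).isSelfAdjoint.star_eq
  have hR := CFC.sqrt_mul_sqrt_self X hX
  have hT := CFC.sqrt_mul_sqrt_self Y hY
  have h := N.map_mul_conjTranspose_self
    (fromBlocks (CFC.sqrt X) 0 (CFC.sqrt Y) (0 : Matrix n n ℂ))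
  simp only [fromBlocks_conjTranspose, fromBlocks_multiply, hRh, hTh, hR, hT,
    conjTranspose_zero, mul_zero, zero_mul, add_zero] at h
  exact (N.map_pinching_le _ _ _ _).trans h.le

end SymmetricNorm

end

/-! ### The norm inequality for the block matrix. -/

open Matrix in
theorem corollary2p4 {n : Type*} [Fintype n] [DecidableEq n] (A B : Matrix n n ℂ)
    (f : ℝ → ℝ) (hf_nonneg : ∀ t : ℝ, 0 ≤ t → 0 ≤ f t)
    (hf_concave : ConcaveOn ℝ (Set.Ici 0) f) (hf_econvex : EConvex f)
    (N : SymmetricNorm (n ⊕ n)) :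
    N (cfc f (CFC.abs (Matrix.fromBlocks A 1 1 B))) ≤
      N.restrict (cfc f (CFC.abs Aᴴ) + 2 • cfc f (1 : Matrix n n ℂ) + cfc f (CFC.abs B)) := by
  obtain ⟨V₁, hV₁, Q₁, hQ₁, p, hp, rfl⟩ := exists_singular_value_decomposition A
  obtain ⟨V₂, hV₂, Q₂, hQ₂, q, hq, rfl⟩ := exists_singular_value_decomposition B
  have hpd : (diagonal fun i => (p i : ℂ))ᴴ = diagonal fun i => (p i : ℂ) := by
    rw [diagonal_conjTranspose]; congr 1; ext i; simp
  have hcalc : ∀ {U : Matrix n n ℂ} (_ : U ∈ unitaryGroup n ℂ) (x : n → ℝ),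
      U * diagonal (fun i => (f (x i) : ℂ)) * Uᴴ + cfc f (1 : Matrix n n ℂ) =
        U * diagonal (fun i => ((f (x i) + f 1 : ℝ) : ℂ)) * Uᴴ := by
    intro U hU x
    have h1 : cfc f (1 : Matrix n n ℂ) = U * diagonal (fun _ => ((f 1 : ℝ) : ℂ)) * Uᴴ := by
      have h := cfc_conj_diagonal hU (fun _ => 1) f
      have hU' : U * Uᴴ = 1 := mem_unitaryGroup_iff.1 hU
      simpa [hU'] using h
    rw [h1, ← add_mul, ← mul_add, diagonal_add]
    simp
  -- One of the two copies of `f(I)` goes to each summand.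
  have hrhs : cfc f (CFC.abs (V₁ * diagonal (fun i => (p i : ℂ)) * Q₁ᴴ)ᴴ) +
        2 • cfc f (1 : Matrix n n ℂ) + cfc f (CFC.abs (V₂ * diagonal (fun i => (q i : ℂ)) * Q₂ᴴ)) =
      V₁ * diagonal (fun i => ((f (p i) + f 1 : ℝ) : ℂ)) * V₁ᴴ +
        Q₂ * diagonal (fun i => ((f (q i) + f 1 : ℝ) : ℂ)) * Q₂ᴴ := by
    rw [conjTranspose_mul, conjTranspose_mul, hpd, conjTranspose_conjTranspose, ← mul_assoc,
      abs_eq_of_singular_value_decomposition hQ₁ hV₁ hp,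
      abs_eq_of_singular_value_decomposition hV₂ hQ₂ hq, cfc_conj_diagonal hV₁,
      cfc_conj_diagonal hQ₂, ← hcalc hV₁, ← hcalc hQ₂, two_smul]
    abel
  have hf1 : 0 ≤ f 1 := hf_nonneg 1 zero_le_one
  have hpos : ∀ (U : Matrix n n ℂ) {x : n → ℝ}, (∀ i, 0 ≤ x i) →
      0 ≤ U * diagonal (fun i => ((f (x i) + f 1 : ℝ) : ℂ)) * Uᴴ := fun U x hx =>
    conj_diagonal_nonneg U fun i => add_nonneg (hf_nonneg _ (hx i)) hf1
  have hswap : fromBlocks 0 1 1 (0 : Matrix n n ℂ) ∈ unitaryGroup (n ⊕ n) ℂ := by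
    rw [mem_unitaryGroup_iff, star_eq_conjTranspose]
    simp [fromBlocks_conjTranspose, fromBlocks_multiply]
  have hS : fromBlocks (V₁ * diagonal (fun i => (p i : ℂ)) * Q₁ᴴ) 1 1
        (V₂ * diagonal (fun i => (q i : ℂ)) * Q₂ᴴ) =
      fromBlocks V₁ 0 0 V₂ * diagonal (fun i => ((Sum.elim p q i : ℝ) : ℂ)) *
        (fromBlocks Q₁ 0 0 Q₂)ᴴ + fromBlocks 0 1 1 0 := by
    have : (diagonal fun i => ((Sum.elim p q i : ℝ) : ℂ)) = fromBlocks
        (diagonal fun i => (p i : ℂ)) 0 0 (diagonal fun i => (q i : ℂ)) := by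
      rw [fromBlocks_diagonal]; congr 1; ext i; cases i <;> rfl
    rw [this, fromBlocks_conjTranspose, fromBlocks_multiply, fromBlocks_multiply, fromBlocks_add]
    simp
  rw [hrhs, hS]
  refine le_trans ?_ (N.map_fromBlocks_le_restrict_add (hpos V₁ hp) (hpos Q₂ hq))
  refine (N.map_cfc_abs_add_unitary_le (hf_concave.monotoneOn_of_nonneg hf_nonneg) hf_econvex
    hf_nonneg (h := fun i => f (Sum.elim p q i) + f 1) ?_ ?_
    (fromBlocks_diagonal_mem_unitaryGroup hV₁ hV₂)
    (fromBlocks_diagonal_mem_unitaryGroup hQ₁ hQ₂) hswap).trans (le_of_eq ?_)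
  · rintro (i | i)
    exacts [hp i, hq i]
  · rintro (i | i)
    exacts [hf_concave.map_add_le (hf_nonneg 0 le_rfl) (hp i) zero_le_one,
      hf_concave.map_add_le (hf_nonneg 0 le_rfl) (hq i) zero_le_one]
  -- Only the diagonal entries matter to the norm, so each block may be conjugated by any unitary;
  -- `V₁` and `Q₂` are those producing `|A*|` and `|B|`.
  · rw [← N.map_unitary_mul_diagonal_mul (fromBlocks_diagonal_mem_unitaryGroup hV₁ hQ₂)]
    have : (diagonal fun i => ((f (Sum.elim p q i) + f 1 : ℝ) : ℂ)) = fromBlocks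
        (diagonal fun i => ((f (p i) + f 1 : ℝ) : ℂ)) 0 0
        (diagonal fun i => ((f (q i) + f 1 : ℝ) : ℂ)) := by
      rw [fromBlocks_diagonal]; congr 1; ext i; cases i <;> rfl
    rw [this, fromBlocks_conjTranspose, fromBlocks_multiply, fromBlocks_multiply]
    simp
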